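/- Fix an integer $d\ge 2$ and reals $B>A>0$. For every $n$ let the following be given: an orthonormal basis $\{|1\rangle_j,\dots,|d\rangle_j\}$ of $\mathbb{C}^d$ for every site $j\in\{1,\dots,n\}$; a set $I_n\subseteq\{1,\dots,n\}$ of sites (for instance all of them); a number $s_n$; and, for $m=0,1,\dots,s_n$, real numbers $a^{(n)}_{i,m}$ indexed by $i=(i_1,\dots,i_n)\in\{1,\dots,d\}^n$. For a choice $\phi$ of an orthonormal basis $\{|\phi_1\rangle_j,\dots,|\phi_d\rangle_j\}$ of $\mathbb{C}^d$ at every site $j\in I_n$ (chosen independently for different sites), put $$A_m(\phi)=\sum_{i}a^{(n)}_{i,m}\Big(\bigotimes_{j\in I_n}|\phi_{i_j}\rangle_j\langle\phi_{i_j}|_j\Big)\otimes\Big(\bigotimes_{j\notin I_n}|i_j\rangle_j\langle i_j|_j\Big),\qquad 0\le m\le s_n,$$ an operator on $(\mathbb{C}^d)^{\otimes n}$ whose operator norm $\|A_m\|=\max_i|a^{(n)}_{i,m}|$ does not depend on $\phi$, and let $$S_{LD}^{(n)}=\Big\{A_0(\phi)+\sum_{m=1}^{s_n}\mu_mA_m(\phi)\;:\;\mu_m\in[-B,-A]\cup[A,B]\text{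 for all }m,\ \phi\text{ as above}\Big\}.$$ Assume that $s_n\le d^{o(n)}$, $\|A_0\|\le d^{o(n)}$ and $\max_{1\le m\le s_n}\|A_m\|=\Theta(n)$ as $n\to\infty$. For a unit vector $|\psi\rangle$ and a Hermitian operator $H$ let $F_Q(|\psi\rangle,H)=4\big(\langle\psi|H^2|\psi\rangle-\langle\psi|H|\psi\rangle^2\big)$ be the quantum Fisher information. Then for every constant $c>0$, for a Haar-random pure state, that is, a uniformly distributed unit vector $|\psi\rangle$ in $(\mathbb{C}^d)^{\otimes n}$, $$\Pr_{|\psi\rangle}\Big(\sup_{H\in S_{LD}^{(n)}}\Big(F_Q(|\psi\rangle,H)-\max_{|\Phi\rangle\ \mathrm{separable}}F_Q(|\Phi\rangle,H)\Big)>c\Big)\longrightarrow 0\qquad(n\to\infty),$$ where the maximum is over the product states $|\Phi\rangle=|v_1\rangle\otimes\cdots\otimes|v_n\rangle$ with unit vectors $|v_j\rangle\in\mathbb{C}^d$. -/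

import Mathlib

open MeasureTheory Filter Topology Asymptotics

noncomputable section

namespace QMetrology

/-- The Hilbert space `ℂ^d` of one qudit. -/
abbrev Qudit (d : ℕ) : Type := EuclideanSpace ℂ (Fin d)

/-- The Hilbert space `(ℂ^d)^{⊗ n}` of `n` qudits, in coordinates with respect to the computational
basis `|i_1 … i_n⟩`, which is indexed by `Fin n → Fin d`. -/
abbrev Qudits (n d : ℕ) : Type := EuclideanSpace ℂ (Fin n → Fin d)

/-- The product vector `v_1 ⊗ ⋯ ⊗ v_n`. -/
def productVec {n d : ℕ} (v : Fin n → Qudit d) : Qudits n d :=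
  WithLp.toLp 2 (fun i => ∏ j, v j (i j))

/-- Operators on `n` qudits; `‖·‖` is the operator norm, that is, the largest singular value. -/
abbrev Operator (n d : ℕ) : Type := Qudits n d →L[ℂ] Qudits n d

/-- The quantum Fisher information `4 (⟨ψ|H²|ψ⟩ - ⟨ψ|H|ψ⟩²)` of the pure state `ψ`. -/
def qfi {n d : ℕ} (ψ : Qudits n d) (H : Operator n d) : ℝ :=
  4 * ((inner ℂ ψ ((H ^ 2) ψ)).re - (inner ℂ ψ (H ψ)).re ^ 2)

/-- The set of separable pure states: tensor products of unit vectors. -/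
def separableStates (n d : ℕ) : Set (Qudits n d) :=
  {Φ | ∃ v : Fin n → Qudit d, (∀ j, ‖v j‖ = 1) ∧ Φ = productVec v}

/-- The optimal quantum Fisher information of separable pure states. -/
def maxSepQFI {n d : ℕ} (H : Operator n d) : ℝ :=
  sSup ((fun Φ => qfi Φ H) '' separableStates n d)

/-- An orthonormal basis of `ℂ^d` for each of the `n` sites. -/
abbrev LocalBases (n d : ℕ) : Type := Fin n → OrthonormalBasis (Fin d) ℂ (Qudit d)

/-- The locally diagonalizable operator
`∑_{(i_1,…,i_n)} a_{(i_1,…,i_n)} ⨂_j |b_{i_j}⟩_j⟨b_{i_j}|_j`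
with real eigenvalues `a` in the product basis given by `b`. -/
def locDiag {n d : ℕ} (b : LocalBases n d) (a : (Fin n → Fin d) → ℝ) : Operator n d :=
  ∑ i : Fin n → Fin d, (a i : ℂ) •
    InnerProductSpace.rankOne ℂ (productVec fun j => b j (i j)) (productVec fun j => b j (i j))

/-- The bases `φ` on the sites in `I`, and the fixed bases `e` on the other sites. -/
def mixBases {n d : ℕ} (I : Finset (Fin n)) (φ e : LocalBases n d) : LocalBases n d :=
  fun j => if j ∈ I then φ j else e j

/-- The set of the Hamiltonians `A_0 + ∑_m μ_m A_m` with `μ_m ∈ [-B,-A] ∪ [A,B]`, where the `A_m`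
have the fixed eigenvalues `a0`, `a m` in a common product basis that is arbitrary on the sites
in `I` and is the fixed one `e` on the other sites. -/
def hamiltonianSet {n d s : ℕ} (A B : ℝ) (I : Finset (Fin n)) (e : LocalBases n d)
    (a0 : (Fin n → Fin d) → ℝ) (a : Fin s → (Fin n → Fin d) → ℝ) : Set (Operator n d) :=
  {H | ∃ (φ : LocalBases n d) (μ : Fin s → ℝ),
    (∀ m, μ m ∈ Set.Icc (-B) (-A) ∪ Set.Icc A B) ∧
    H = locDiag (mixBases I φ e) a0 + ∑ m, (μ m : ℂ) • locDiag (mixBases I φ e) (a m)}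

/-- The law of a Haar random pure state: the uniform probability measure on the unit sphere. -/
def haarState (n d : ℕ) : Measure (Metric.sphere (0 : Qudits n d) 1) :=
  ((volume : Measure (Qudits n d)).toSphere Set.univ)⁻¹ • (volume : Measure (Qudits n d)).toSphere

/-- `f n = d^{o(n)}`, read as an upper bound. -/
def IsSubexp (d : ℕ) (f : ℕ → ℝ) : Prop :=
  ∃ g : ℕ → ℝ, g =o[atTop] (fun n : ℕ => (n : ℝ)) ∧ ∀ᶠ n in atTop, f n ≤ (d : ℝ) ^ g n

end QMetrology

end

/-! In the product basis of `H`, the Fisher information of `ψ` is four times the variance of the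
eigenvalues under the outcome distribution of `ψ` (`qfi_locDiag`). Some product state has the
uniform outcome distribution, so the advantage of `ψ` is at most four times the excess of the second
central moment over its uniform value (`qfi_sub_maxSepQFI_le`). Expanding that moment in the
centered eigenvalue families leaves `(s+1)^2` pair products, which depend on neither `φ` nor `μ`
(`sum_sq_mul_sub_le`). It remains to bound the deviation of each pair product simultaneously for all
local bases. For one basis, a Gaussian form of the Chernoff bound gives a failure probability
`exp(-Ω(d^n t^2 / L^2))` (`toSphere_concentration`). Local bases have only `2nd^2` real coordinates,
so a grid of exponentially fine mesh has `exp(O(n^2))` cells (`haarState_exists_basis_le`). The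
doubly exponential concentration absorbs this count, the number of pairs and the `d^{o(n)}` losses.
-/

namespace QMetrology

/-! ### Gaussian integrals on complex Euclidean space -/

section Gaussian

variable {ι : Type*} [Fintype ι]

/-- A non-integrable function would have Bochner integral 0, contradicting the positive value in the
Gaussian formula. -/
theorem integrable_exp_neg_mul_normSq {b : ℝ} (hb : 0 < b) :
    Integrable fun z : ℂ => Real.exp (-b * ‖z‖ ^ 2) := by
  by_contra h
  have h1 := GaussianFourier.integral_rexp_neg_mul_sq_norm (V := ℂ) hb
  rw [integral_undef h] at h1
  have : (0 : ℝ) < (Real.pi / b) ^ ((Module.finrank ℝ ℂ : ℝ) / 2) :=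
    Real.rpow_pos_of_pos (div_pos Real.pi_pos hb) _
  linarith

theorem integral_exp_neg_mul_normSq {b : ℝ} (hb : 0 < b) :
    ∫ z : ℂ, Real.exp (-b * ‖z‖ ^ 2) = b⁻¹ * Real.pi := by
  rw [GaussianFourier.integral_rexp_neg_mul_sq_norm hb]
  simp
  field_simp

theorem integral_exp_neg_sum_pi (w : ι → ℝ) (hw : ∀ i, 0 < w i) :
    ∫ x : ι → ℂ, Real.exp (-∑ i, w i * ‖x i‖ ^ 2) = ∏ i, ((w i)⁻¹ * Real.pi) := by
  have : ∀ x : ι → ℂ, Real.exp (-∑ i, w i * ‖x i‖ ^ 2)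
      = ∏ i, Real.exp (-(w i) * ‖x i‖ ^ 2) := by
    intro x
    rw [← Real.exp_sum, ← Finset.sum_neg_distrib]
    simp
  simp_rw [this]
  rw [integral_fintype_prod_volume_eq_prod (fun i (z : ℂ) => Real.exp (-(w i) * ‖z‖ ^ 2))]
  exact Finset.prod_congr rfl fun i _ => integral_exp_neg_mul_normSq (hw i)

theorem integrable_exp_neg_sum_pi (w : ι → ℝ) (hw : ∀ i, 0 < w i) :
    Integrable fun x : ι → ℂ => Real.exp (-∑ i, w i * ‖x i‖ ^ 2) := by
  have : (fun x : ι → ℂ => Real.exp (-∑ i, w i * ‖x i‖ ^ 2))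
      = fun x => ∏ i, Real.exp (-(w i) * ‖x i‖ ^ 2) := by
    ext x
    rw [← Real.exp_sum, ← Finset.sum_neg_distrib]
    simp
  rw [this]
  exact Integrable.fintype_prod (f := fun i (z : ℂ) => Real.exp (-(w i) * ‖z‖ ^ 2))
    fun i => integrable_exp_neg_mul_normSq (hw i)

theorem lintegral_exp_neg_sum_pi (w : ι → ℝ) (hw : ∀ i, 0 < w i) :
    ∫⁻ x : ι → ℂ, ENNReal.ofReal (Real.exp (-∑ i, w i * ‖x i‖ ^ 2))
      = ENNReal.ofReal (∏ i, (w i)⁻¹) * ENNReal.ofReal (Real.pi ^ Fintype.card ι) := by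
  rw [← ofReal_integral_eq_lintegral_ofReal (integrable_exp_neg_sum_pi w hw)
    (Eventually.of_forall fun x => (Real.exp_pos _).le), integral_exp_neg_sum_pi w hw,
    ← ENNReal.ofReal_mul (Finset.prod_nonneg fun i _ => (inv_pos.2 (hw i)).le),
    Finset.prod_mul_distrib, Finset.prod_const, Finset.card_univ]

/-- The volume of `EuclideanSpace ℂ ι` is a multiple of the product measure. -/
theorem exists_map_toLp_volume :
    ∃ k : ENNReal, k ≠ 0 ∧ k ≠ ⊤ ∧ (volume : Measure (EuclideanSpace ℂ ι))
      = k • (volume : Measure (ι → ℂ)).map (WithLp.toLp 2) := by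
  let e : (ι → ℂ) ≃L[ℝ] EuclideanSpace ℂ ι := (PiLp.continuousLinearEquiv 2 ℝ fun _ : ι => ℂ).symm
  have he : (volume : Measure (ι → ℂ)).map (WithLp.toLp 2) = (volume : Measure (ι → ℂ)).map e := rfl
  rw [he]
  have := e.isAddHaarMeasure_map (volume : Measure (ι → ℂ))
  refine ⟨_, ?_, ?_, Measure.isAddLeftInvariant_eq_smul volume ((volume : Measure (ι → ℂ)).map e)⟩
  · exact_mod_cast (Measure.addHaarScalarFactor_pos_of_isAddHaarMeasure _ _).ne'
  · exact ENNReal.coe_ne_top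

/-- Comparison with unit weights hides both the power of `π` and the unknown scaling between the two
Haar measures in the last integral. -/
theorem lintegral_exp_neg_sum (w : ι → ℝ) (hw : ∀ i, 0 < w i) :
    ∫⁻ x : EuclideanSpace ℂ ι, ENNReal.ofReal (Real.exp (-∑ i, w i * ‖x i‖ ^ 2))
      = ENNReal.ofReal (∏ i, (w i)⁻¹) *
        ∫⁻ x : EuclideanSpace ℂ ι, ENNReal.ofReal (Real.exp (-‖x‖ ^ 2)) := by
  obtain ⟨k, -, -, hk⟩ := exists_map_toLp_volume (ι := ι)
  have key : ∀ v : ι → ℝ, (∀ i, 0 < v i) →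
      ∫⁻ x : EuclideanSpace ℂ ι, ENNReal.ofReal (Real.exp (-∑ i, v i * ‖x i‖ ^ 2))
        = k * (ENNReal.ofReal (∏ i, (v i)⁻¹) * ENNReal.ofReal (Real.pi ^ Fintype.card ι)) := by
    intro v hv
    rw [hk, lintegral_smul_measure, lintegral_map (by fun_prop) (by fun_prop), smul_eq_mul,
      ← lintegral_exp_neg_sum_pi v hv]
  have h1 := key (fun _ => 1) fun _ => one_pos
  simp only [one_mul, inv_one, Finset.prod_const_one, ENNReal.ofReal_one] at h1
  simp_rw [EuclideanSpace.norm_sq_eq]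
  rw [h1, key w hw]
  ring

theorem lintegral_exp_neg_normSq_pos_and_finite :
    (∫⁻ x : EuclideanSpace ℂ ι, ENNReal.ofReal (Real.exp (-‖x‖ ^ 2))) ≠ 0 ∧
    (∫⁻ x : EuclideanSpace ℂ ι, ENNReal.ofReal (Real.exp (-‖x‖ ^ 2))) ≠ ⊤ := by
  obtain ⟨k, hk0, hkt, hk⟩ := exists_map_toLp_volume (ι := ι)
  have h : (∫⁻ x : EuclideanSpace ℂ ι, ENNReal.ofReal (Real.exp (-‖x‖ ^ 2)))
      = k * ENNReal.ofReal (Real.pi ^ Fintype.card ι) := by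
    have h2 := lintegral_exp_neg_sum_pi (ι := ι) (fun _ => 1) fun _ => one_pos
    simp only [one_mul, inv_one, Finset.prod_const_one, ENNReal.ofReal_one] at h2
    simp_rw [EuclideanSpace.norm_sq_eq]
    rw [hk, lintegral_smul_measure, lintegral_map (by fun_prop) (by fun_prop), smul_eq_mul, ← h2]
  rw [h]
  refine ⟨mul_ne_zero hk0 ?_, ENNReal.mul_ne_top hkt ENNReal.ofReal_ne_top⟩
  simpa using pow_pos Real.pi_pos _

end Gaussian

/-! ### Polar coordinates on cones -/

section Polar

variable {E : Type*} [NormedAddCommGroup E] [NormedSpace ℝ E] [MeasurableSpace E] [BorelSpace E]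
  [FiniteDimensional ℝ E]

/-- Integration of a radial function over a cone. -/
theorem setLIntegral_cone_eq [Nontrivial E] (μ : Measure E) [μ.IsAddHaarMeasure] {C : Set E}
    (hC : MeasurableSet C) (hcone : ∀ (r : ℝ) (x : E), 0 < r → (r • x ∈ C ↔ x ∈ C))
    {f : ℝ → ENNReal} (hf : Measurable f) :
    ∫⁻ x in C, f ‖x‖ ∂μ = μ.toSphere (Subtype.val ⁻¹' C) *
      ∫⁻ r, f (r : ℝ) ∂(Measure.volumeIoiPow (Module.finrank ℝ E - 1)) := by
  have hS : MeasurableSet (Subtype.val ⁻¹' C : Set (Metric.sphere (0 : E) 1)) :=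
    measurable_subtype_coe hC
  have h1 : ∫⁻ x in C, f ‖x‖ ∂μ
      = ∫⁻ x : ({0}ᶜ : Set E), C.indicator (fun x => f ‖x‖) x ∂(μ.comap (↑)) := by
    rw [lintegral_subtype_comap (measurableSet_singleton _).compl, restrict_compl_singleton,
      lintegral_indicator hC]
  let G : Metric.sphere (0 : E) 1 × Set.Ioi (0 : ℝ) → ENNReal := fun p =>
    (Subtype.val ⁻¹' C : Set (Metric.sphere (0 : E) 1)).indicator 1 p.1 * f (p.2 : ℝ)
  have hG : Measurable G := ((measurable_one.indicator hS).comp measurable_fst).mul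
      ((hf.comp measurable_subtype_coe).comp measurable_snd)
  have h2 : ∀ x : ({0}ᶜ : Set E), C.indicator (fun x => f ‖x‖) (x : E)
      = G (homeomorphUnitSphereProd E x) := by
    intro x
    have hx : 0 < ‖(x : E)‖ := norm_pos_iff.2 x.2
    have hmem : ((homeomorphUnitSphereProd E x).1 : E) ∈ C ↔ (x : E) ∈ C := by
      simpa using hcone ‖(x : E)‖⁻¹ x (inv_pos.2 hx)
    have hnorm : ((homeomorphUnitSphereProd E x).2 : ℝ) = ‖(x : E)‖ := by simp
    have hmem' : (homeomorphUnitSphereProd E x).1 ∈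
      (Subtype.val ⁻¹' C : Set (Metric.sphere (0 : E) 1)) ↔ (x : E) ∈ C := hmem
    by_cases h : (x : E) ∈ C
    · simp only [G, Set.indicator_of_mem (hmem'.2 h), Set.indicator_of_mem h, hnorm,
        Pi.one_apply, one_mul]
    · simp only [G, Set.indicator_of_notMem (mt hmem'.1 h), Set.indicator_of_notMem h, zero_mul]
  have h3 := μ.measurePreserving_homeomorphUnitSphereProd.lintegral_comp hG
  rw [h1, lintegral_congr h2, h3]
  have h4 := lintegral_prod_mul (μ := μ.toSphere)
    (ν := Measure.volumeIoiPow (Module.finrank ℝ E - 1))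
    (f := (Subtype.val ⁻¹' C : Set (Metric.sphere (0 : E) 1)).indicator 1)
    (g := fun r : Set.Ioi (0 : ℝ) => f (r : ℝ)) (measurable_one.indicator hS).aemeasurable
    (hf.comp measurable_subtype_coe).aemeasurable
  rw [lintegral_indicator_one hS] at h4
  exact h4

end Polar

/-! ### Concentration on the sphere for one fixed basis -/

section Concentration

variable {ι : Type*} [Fintype ι]

/-- The exponential Markov inequality for a diagonal quadratic form on the sphere. -/
theorem toSphere_quadForm_pos_le [Nonempty ι] (b : OrthonormalBasis ι ℂ (EuclideanSpace ℂ ι))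
    (y : ι → ℝ) (hy : ∀ i, y i < 1) :
    ((volume : Measure (EuclideanSpace ℂ ι)).toSphere Set.univ)⁻¹ *
      (volume : Measure (EuclideanSpace ℂ ι)).toSphere
        {ψ | 0 < ∑ i, y i * ‖inner ℂ (b i) (ψ : EuclideanSpace ℂ ι)‖ ^ 2}
      ≤ ENNReal.ofReal (∏ i, (1 - y i)⁻¹) := by
  set C : Set (EuclideanSpace ℂ ι) := {x | 0 < ∑ i, y i * ‖inner ℂ (b i) x‖ ^ 2} with hCdef
  have hCm : MeasurableSet C := measurableSet_lt measurable_const (by fun_prop)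
  have hcone : ∀ (r : ℝ) (x : EuclideanSpace ℂ ι), 0 < r → (r • x ∈ C ↔ x ∈ C) := by
    intro r x hr
    have : ∑ i, y i * ‖inner ℂ (b i) (r • x)‖ ^ 2
        = r ^ 2 * ∑ i, y i * ‖inner ℂ (b i) x‖ ^ 2 := by
      rw [Finset.mul_sum]
      refine Finset.sum_congr rfl fun i _ => ?_
      rw [← Complex.coe_smul, inner_smul_right, norm_mul, mul_pow]
      simp
      ring
    simp only [hCdef, Set.mem_ofPred_eq, this]
    exact mul_pos_iff_of_pos_left (by positivity)
  have hf : Measurable fun r : ℝ => ENNReal.ofReal (Real.exp (-r ^ 2)) := by fun_prop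
  have hE : Nontrivial (EuclideanSpace ℂ ι) := inferInstance
  -- The event is a cone, so Gaussian integrals over it and over the whole space share one radial
  -- factor, which cancels in the ratio.
  have hA := setLIntegral_cone_eq (volume : Measure (EuclideanSpace ℂ ι)) hCm hcone hf
  have hB := setLIntegral_cone_eq (volume : Measure (EuclideanSpace ℂ ι)) MeasurableSet.univ
    (by simp) hf
  rw [Measure.restrict_univ, Set.preimage_univ] at hB
  -- On `C` the form is positive, so adding it to the exponent only increases the integrand; the
  -- result is a Gaussian with weights `1 - y i` in the rotated coordinates.
  have hle : ∫⁻ x in C, ENNReal.ofReal (Real.exp (-‖x‖ ^ 2))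
      ≤ ENNReal.ofReal (∏ i, (1 - y i)⁻¹) *
        ∫⁻ x : EuclideanSpace ℂ ι, ENNReal.ofReal (Real.exp (-‖x‖ ^ 2)) := by
    rw [← lintegral_exp_neg_sum (fun i => 1 - y i) fun i => sub_pos.2 (hy i)]
    have hrot : MeasurePreserving b.repr (volume : Measure (EuclideanSpace ℂ ι)) volume :=
      LinearIsometryEquiv.measurePreserving
        (⟨b.repr.toLinearEquiv.restrictScalars ℝ, b.repr.norm_map⟩ :
          EuclideanSpace ℂ ι ≃ₗᵢ[ℝ] EuclideanSpace ℂ ι)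
    rw [← hrot.lintegral_comp (by fun_prop)]
    refine le_trans (setLIntegral_mono (by fun_prop) fun x hx => ?_) (setLIntegral_le_lintegral C _)
    refine ENNReal.ofReal_le_ofReal (Real.exp_le_exp.2 ?_)
    have hn : ‖x‖ ^ 2 = ∑ i, ‖inner ℂ (b i) x‖ ^ 2 := (b.sum_sq_norm_inner_right x).symm
    simp only [hCdef, Set.mem_ofPred_eq] at hx
    simp_rw [b.repr_apply_apply, sub_mul, one_mul, Finset.sum_sub_distrib]
    rw [hn]
    linarith
  rw [hA, hB] at hle
  obtain ⟨hz, ht⟩ := lintegral_exp_neg_normSq_pos_and_finite (ι := ι)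
  rw [hB] at hz ht
  set R := ∫⁻ r : Set.Ioi (0 : ℝ), ENNReal.ofReal (Real.exp (-(r : ℝ) ^ 2))
    ∂(Measure.volumeIoiPow (Module.finrank ℝ (EuclideanSpace ℂ ι) - 1))
  set T := (volume : Measure (EuclideanSpace ℂ ι)).toSphere Set.univ
  have hR0 : R ≠ 0 := right_ne_zero_of_mul hz
  have hT0 : T ≠ 0 := left_ne_zero_of_mul hz
  have hTt : T ≠ ⊤ := measure_ne_top _ _
  have hRt : R ≠ ⊤ := fun h => ht (by rw [h, ENNReal.mul_top hT0])
  rw [← mul_assoc, ENNReal.mul_le_mul_iff_left hR0 hRt] at hle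
  rw [ENNReal.inv_mul_le_iff hT0 hTt, mul_comm]
  exact hle

/-- From `(1 - y)(1 + y + 2y²) = 1 + y²(1 - 2y) ≥ 1`. -/
theorem inv_one_sub_le_exp {y : ℝ} (hy : y ≤ 1 / 2) :
    (1 - y)⁻¹ ≤ Real.exp (y + 2 * y ^ 2) := by
  have h1 : 0 < 1 - y := by linarith
  refine le_trans ?_ (Real.add_one_le_exp _)
  rw [inv_le_iff_one_le_mul₀ h1]
  nlinarith [mul_nonneg (sq_nonneg y) (by linarith : (0 : ℝ) ≤ 1 - 2 * y)]

/-- Concentration of the expectation of a diagonal observable in a uniformly random state. -/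
theorem toSphere_concentration [Nonempty ι] (b : OrthonormalBasis ι ℂ (EuclideanSpace ℂ ι))
    (x : ι → ℝ) {L t : ℝ} (ht : 0 < t) (htL : t ≤ L) (hx : ∀ i, |x i| ≤ L) :
    ((volume : Measure (EuclideanSpace ℂ ι)).toSphere Set.univ)⁻¹ *
      (volume : Measure (EuclideanSpace ℂ ι)).toSphere
        {ψ | (∑ i, x i) / Fintype.card ι + t <
          ∑ i, x i * ‖inner ℂ (b i) (ψ : EuclideanSpace ℂ ι)‖ ^ 2}
      ≤ ENNReal.ofReal (Real.exp (-(Fintype.card ι * t ^ 2 / (72 * L ^ 2)))) := by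
  have hL : 0 < L := ht.trans_le htL
  have hD : (0 : ℝ) < Fintype.card ι := by exact_mod_cast Fintype.card_pos
  set D : ℝ := (Fintype.card ι : ℝ) with hDdef
  set m : ℝ := (∑ i, x i) / D with hm
  -- This `l` minimizes the exponent `D(-lt + 18 l²L²)` obtained below, with minimum `-Dt²/(72L²)`;
  -- `t ≤ L` keeps `l · 3L` below `1/2`.
  set l : ℝ := t / (36 * L ^ 2) with hl
  have hl0 : 0 < l := by positivity
  have hmL : |m| ≤ L := by
    rw [hm, abs_div, abs_of_pos hD, div_le_iff₀ hD]
    refine (Finset.abs_sum_le_sum_abs _ _).trans ((Finset.sum_le_sum fun i _ => hx i).trans ?_)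
    rw [Finset.sum_const, Finset.card_univ, nsmul_eq_mul, ← hDdef, mul_comm]
  have hu : ∀ i, |x i - m - t| ≤ 3 * L := by
    intro i
    have h1 := abs_le.1 (hx i)
    have h2 := abs_le.1 hmL
    rw [abs_le]
    constructor <;> linarith
  have hlL : l * (3 * L) ≤ 1 / 2 := by
    rw [hl]
    have : t / (36 * L ^ 2) * (3 * L) = t / L / 12 := by field_simp; ring
    rw [this]
    have : t / L ≤ 1 := (div_le_one hL).2 htL
    linarith
  have hy : ∀ i, l * (x i - m - t) ≤ 1 / 2 := fun i =>
    (mul_le_mul_of_nonneg_left ((le_abs_self _).trans (hu i)) hl0.le).trans hlL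
  have hmain := toSphere_quadForm_pos_le b (fun i => l * (x i - m - t))
    fun i => (hy i).trans_lt (by norm_num)
  refine le_trans ?_ (hmain.trans (ENNReal.ofReal_le_ofReal ?_))
  · refine mul_le_mul' le_rfl (measure_mono fun ψ h => ?_)
    rw [Set.mem_ofPred_eq] at h ⊢
    have hψ : ∑ i, ‖inner ℂ (b i) (ψ : EuclideanSpace ℂ ι)‖ ^ 2 = 1 := by
      rw [b.sum_sq_norm_inner_right, norm_eq_of_mem_sphere, one_pow]
    have : ∑ i, l * (x i - m - t) * ‖inner ℂ (b i) (ψ : EuclideanSpace ℂ ι)‖ ^ 2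
        = l * (∑ i, x i * ‖inner ℂ (b i) (ψ : EuclideanSpace ℂ ι)‖ ^ 2
          - (m + t) * ∑ i, ‖inner ℂ (b i) (ψ : EuclideanSpace ℂ ι)‖ ^ 2) := by
      rw [Finset.mul_sum Finset.univ _ (m + t), ← Finset.sum_sub_distrib, Finset.mul_sum]
      exact Finset.sum_congr rfl fun i _ => by ring
    rw [this, hψ, mul_one]
    exact mul_pos hl0 (sub_pos.2 h)
  · refine (Finset.prod_le_prod (fun i _ => inv_nonneg.2 ?_)
      fun i _ => inv_one_sub_le_exp (hy i)).trans ?_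
    · linarith [hy i]
    rw [← Real.exp_sum, Real.exp_le_exp, Finset.sum_add_distrib]
    have h1 : ∑ i, l * (x i - m - t) = -(D * (l * t)) := by
      rw [← Finset.mul_sum, Finset.sum_sub_distrib, Finset.sum_sub_distrib]
      simp only [Finset.sum_const, Finset.card_univ, nsmul_eq_mul, ← hDdef]
      have : ∑ i, x i = m * D := by rw [hm]; field_simp
      rw [this]
      ring
    have h2 : ∑ i, 2 * (l * (x i - m - t)) ^ 2 ≤ D * (2 * (l * (3 * L)) ^ 2) := by
      have : ∀ i ∈ Finset.univ, 2 * (l * (x i - m - t)) ^ 2 ≤ 2 * (l * (3 * L)) ^ 2 := by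
        intro i _
        rw [mul_pow, mul_pow]
        have := sq_le_sq' (by linarith [neg_abs_le (x i - m - t), hu i])
          ((le_abs_self _).trans (hu i))
        gcongr
      refine (Finset.sum_le_sum this).trans ?_
      rw [Finset.sum_const, Finset.card_univ, nsmul_eq_mul, ← hDdef]
    rw [h1]
    refine (add_le_add_right h2 _).trans (le_of_eq ?_)
    rw [hl]
    field_simp
    ring

end Concentration

/-! ### Product bases and outcome probabilities -/

section ProductBasis

variable {n d : ℕ}

theorem inner_productVec (v w : Fin n → Qudit d) :
    inner ℂ (productVec v) (productVec w) = ∏ j, inner ℂ (v j) (w j) := by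
  simp only [PiLp.inner_apply, productVec, RCLike.inner_apply, Finset.prod_univ_sum,
    Fintype.piFinset_univ, map_prod, Finset.prod_mul_distrib]

theorem norm_productVec {v : Fin n → Qudit d} (hv : ∀ j, ‖v j‖ = 1) : ‖productVec v‖ = 1 := by
  have h : ((‖productVec v‖ : ℂ)) ^ 2 = 1 := by
    have h1 := inner_self_eq_norm_sq_to_K (𝕜 := ℂ) (productVec v)
    have h2 : ∀ j, inner ℂ (v j) (v j) = 1 := fun j => by
      simp [inner_self_eq_norm_sq_to_K, hv j]
    rw [inner_productVec, Finset.prod_congr rfl fun j _ => h2 j, Finset.prod_const_one] at h1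
    exact h1.symm
  have h' : ‖productVec v‖ ^ 2 = 1 := by exact_mod_cast h
  exact (pow_eq_one_iff_of_nonneg (norm_nonneg _) two_ne_zero).1 h'

/-- The vector of the product basis with index `i`. -/
noncomputable abbrev productBasisVec (b : LocalBases n d) (i : Fin n → Fin d) : Qudits n d :=
  productVec fun j => b j (i j)

theorem orthonormal_productBasisVec (b : LocalBases n d) :
    Orthonormal ℂ (productBasisVec b) := by
  rw [orthonormal_iff_ite]
  intro i i'
  rw [inner_productVec]
  simp_rw [fun j => (orthonormal_iff_ite.1 (b j).orthonormal) (i j) (i' j)]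
  by_cases h : i = i'
  · simp [h]
  · obtain ⟨j, hj⟩ := Function.ne_iff.1 h
    rw [if_neg h, Finset.prod_eq_zero (Finset.mem_univ j) (if_neg hj)]

/-- The product basis of `n` local orthonormal bases. -/
noncomputable def productBasis (b : LocalBases n d) :
    OrthonormalBasis (Fin n → Fin d) ℂ (Qudits n d) :=
  (basisOfLinearIndependentOfCardEqFinrank' (productBasisVec b)
    (orthonormal_productBasisVec b).linearIndependent (by simp)).toOrthonormalBasis
    (by simpa using orthonormal_productBasisVec b)

@[simp]
theorem productBasis_apply (b : LocalBases n d) (i : Fin n → Fin d) :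
    productBasis b i = productBasisVec b i := by
  simp [productBasis]

/-- The probability of the outcome `i` when `ψ` is measured in the product basis of `b`. -/
noncomputable def prob (b : LocalBases n d) (ψ : Qudits n d) (i : Fin n → Fin d) : ℝ :=
  ‖inner ℂ (productBasisVec b i) ψ‖ ^ 2

theorem sum_prob (b : LocalBases n d) {ψ : Qudits n d} (hψ : ‖ψ‖ = 1) : ∑ i, prob b ψ i = 1 := by
  have := (productBasis b).sum_sq_norm_inner_right ψ
  simpa [prob, hψ] using this

end ProductBasis

/-! ### Locally diagonalizable operators and the variance formula -/

section LocDiag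

variable {n d : ℕ}

theorem locDiag_apply (b : LocalBases n d) (h : (Fin n → Fin d) → ℝ) (ψ : Qudits n d) :
    locDiag b h ψ = ∑ i, ((h i : ℂ) * inner ℂ (productBasisVec b i) ψ) • productBasisVec b i := by
  simp only [locDiag, sum_apply, smul_apply, InnerProductSpace.rankOne_apply, smul_smul]

theorem inner_locDiag_apply (b : LocalBases n d) (h : (Fin n → Fin d) → ℝ) (ψ : Qudits n d)
    (i : Fin n → Fin d) :
    inner ℂ (productBasisVec b i) (locDiag b h ψ) = h i * inner ℂ (productBasisVec b i) ψ := by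
  rw [locDiag_apply, (orthonormal_productBasisVec b).inner_right_fintype]

/-- Parseval; leaving `χ` general covers both `Hψ` and `H²ψ`. -/
theorem inner_self_of_inner_eq (b : LocalBases n d) (h : (Fin n → Fin d) → ℝ) (ψ χ : Qudits n d)
    (hχ : ∀ i, inner ℂ (productBasisVec b i) χ = h i * inner ℂ (productBasisVec b i) ψ) :
    (inner ℂ ψ χ).re = ∑ i, h i * prob b ψ i := by
  have h1 := (productBasis b).sum_inner_mul_inner ψ χ
  rw [← h1, Complex.re_sum]
  refine Finset.sum_congr rfl fun i _ => ?_
  rw [productBasis_apply, hχ, prob, ← inner_conj_symm ψ, mul_left_comm, mul_comm (_ : ℂ) (inner ℂ _ _),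
    Complex.mul_conj, ← Complex.ofReal_mul, Complex.ofReal_re, Complex.normSq_eq_norm_sq]

theorem qfi_locDiag (b : LocalBases n d) (h : (Fin n → Fin d) → ℝ) (ψ : Qudits n d) :
    qfi ψ (locDiag b h) = 4 * (∑ i, h i ^ 2 * prob b ψ i - (∑ i, h i * prob b ψ i) ^ 2) := by
  rw [qfi, inner_self_of_inner_eq b h ψ _ (inner_locDiag_apply b h ψ),
    inner_self_of_inner_eq b (fun i => h i ^ 2) ψ]
  intro i
  rw [pow_two, mul_apply_eq_comp, inner_locDiag_apply, inner_locDiag_apply]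
  push_cast
  ring

/-- Test on an eigenvector. This turns norm hypotheses in the fixed basis into eigenvalue bounds,
which hold whatever the basis. -/
theorem abs_le_norm_locDiag (b : LocalBases n d) (h : (Fin n → Fin d) → ℝ) (i : Fin n → Fin d) :
    |h i| ≤ ‖locDiag b h‖ := by
  have h1 : ‖productBasisVec b i‖ = 1 := (orthonormal_productBasisVec b).1 i
  have h2 := inner_locDiag_apply b h (productBasisVec b i) i
  have h3 : inner ℂ (productBasisVec b i) (productBasisVec b i) = (1 : ℂ) := by
    rw [inner_self_eq_norm_sq_to_K, h1]
    simp
  rw [h3, mul_one] at h2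
  have h4 := norm_inner_le_norm (𝕜 := ℂ) (productBasisVec b i) (locDiag b h (productBasisVec b i))
  rw [h2, h1, one_mul, Complex.norm_real, Real.norm_eq_abs] at h4
  refine h4.trans (((locDiag b h).le_opNorm _).trans ?_)
  rw [h1, mul_one]

theorem locDiag_add_sum {s : ℕ} (b : LocalBases n d) (a0 : (Fin n → Fin d) → ℝ)
    (a : Fin s → (Fin n → Fin d) → ℝ) (μ : Fin s → ℝ) :
    locDiag b a0 + ∑ m, (μ m : ℂ) • locDiag b (a m)
      = locDiag b (fun i => a0 i + ∑ m, μ m * a m i) := by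
  simp only [locDiag, Finset.smul_sum]
  rw [Finset.sum_comm, ← Finset.sum_add_distrib]
  refine Finset.sum_congr rfl fun i _ => ?_
  push_cast
  rw [add_smul, Finset.sum_smul]
  simp only [smul_smul]

end LocDiag

/-! ### Comparison with a separable state -/

section Separable

variable {n d : ℕ}

/-- Serves only to show that the set defining `maxSepQFI` is bounded above, since a real `sSup` of
an unbounded set is 0 by default. -/
theorem qfi_le (ψ : Qudits n d) (hψ : ‖ψ‖ = 1) (H : Operator n d) : qfi ψ H ≤ 4 * ‖H ^ 2‖ := by
  have h1 : (inner ℂ ψ ((H ^ 2) ψ)).re ≤ ‖H ^ 2‖ := by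
    refine (Complex.re_le_norm _).trans ((norm_inner_le_norm _ _).trans ?_)
    have := (H ^ 2).le_opNorm ψ
    rw [hψ] at this ⊢
    linarith
  rw [qfi]
  nlinarith [sq_nonneg (inner ℂ ψ (H ψ)).re]

theorem qfi_le_maxSepQFI {Φ : Qudits n d} (hΦ : Φ ∈ separableStates n d) (H : Operator n d) :
    qfi Φ H ≤ maxSepQFI H := by
  refine le_csSup ⟨4 * ‖H ^ 2‖, ?_⟩ ⟨Φ, hΦ, rfl⟩
  rintro _ ⟨Ψ, ⟨v, hv, rfl⟩, rfl⟩
  exact qfi_le _ (norm_productVec hv) H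

/-- Some product state has the uniform outcome distribution in the product basis. -/
theorem exists_separable_uniform (hd : 0 < d) (b : LocalBases n d) :
    ∃ Φ ∈ separableStates n d, ∀ i, prob b Φ i = ((d : ℝ) ^ n)⁻¹ := by
  have hd' : (0 : ℝ) < d := by exact_mod_cast hd
  -- The equal superposition of the local basis gives each local outcome probability `1/d`.
  let v : Fin n → Qudit d := fun j => ∑ k, (((Real.sqrt d)⁻¹ : ℝ) : ℂ) • b j k
  have hin : ∀ j k, inner ℂ (b j k) (v j) = (((Real.sqrt d)⁻¹ : ℝ) : ℂ) := fun j k =>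
    (b j).orthonormal.inner_right_fintype _ k
  have hv : ∀ j, ‖v j‖ = 1 := by
    intro j
    have h1 := (b j).sum_sq_norm_inner_right (v j)
    simp_rw [hin, Complex.norm_real, Real.norm_eq_abs, sq_abs, inv_pow, Real.sq_sqrt hd'.le] at h1
    rw [Finset.sum_const, Finset.card_univ, Fintype.card_fin, nsmul_eq_mul,
      mul_inv_cancel₀ hd'.ne'] at h1
    exact (pow_eq_one_iff_of_nonneg (norm_nonneg _) two_ne_zero).1 h1.symm
  refine ⟨productVec v, ⟨v, hv, rfl⟩, fun i => ?_⟩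
  rw [prob, inner_productVec]
  simp_rw [hin]
  rw [Finset.prod_const, Finset.card_univ, Fintype.card_fin, norm_pow, Complex.norm_real,
    Real.norm_eq_abs, ← pow_mul, mul_comm n 2, pow_mul, sq_abs, inv_pow, Real.sq_sqrt hd'.le,
    inv_pow]

/-- The advantage of `ψ` over separable states is at most the deviation of the second central
moment in `ψ` from that in the uniform distribution. -/
theorem qfi_sub_maxSepQFI_le (hd : 0 < d) (b : LocalBases n d) (f : (Fin n → Fin d) → ℝ) (t : ℝ)
    (hf : ∑ i, f i = 0) {ψ : Qudits n d} (hψ : ‖ψ‖ = 1) :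
    qfi ψ (locDiag b fun i => f i + t) - maxSepQFI (locDiag b fun i => f i + t)
      ≤ 4 * (∑ i, f i ^ 2 * prob b ψ i - (∑ i, f i ^ 2) / (d : ℝ) ^ n) := by
  have hd' : (0 : ℝ) < (d : ℝ) ^ n := by
    have : (0 : ℝ) < d := by exact_mod_cast hd
    positivity
  -- The variance ignores the shift `t`.
  have key : ∀ p : (Fin n → Fin d) → ℝ, ∑ i, p i = 1 →
      ∑ i, (f i + t) ^ 2 * p i - (∑ i, (f i + t) * p i) ^ 2
        = ∑ i, f i ^ 2 * p i - (∑ i, f i * p i) ^ 2 := by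
    intro p hp
    have h1 : ∑ i, (f i + t) ^ 2 * p i
        = ∑ i, f i ^ 2 * p i + 2 * t * (∑ i, f i * p i) + t ^ 2 * ∑ i, p i := by
      rw [Finset.mul_sum, Finset.mul_sum, ← Finset.sum_add_distrib, ← Finset.sum_add_distrib]
      exact Finset.sum_congr rfl fun i _ => by ring
    have h2 : ∑ i, (f i + t) * p i = ∑ i, f i * p i + t * ∑ i, p i := by
      rw [Finset.mul_sum, ← Finset.sum_add_distrib]
      exact Finset.sum_congr rfl fun i _ => by ring
    rw [h1, h2, hp]
    ring
  obtain ⟨Φ, hΦ, hu⟩ := exists_separable_uniform hd b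
  have h1 := qfi_le_maxSepQFI hΦ (locDiag b fun i => f i + t)
  have hΦ1 : ‖Φ‖ = 1 := by
    obtain ⟨v, hv, rfl⟩ := hΦ
    exact norm_productVec hv
  rw [qfi_locDiag, key _ (sum_prob b hΦ1)] at h1
  -- Under the uniform distribution `f` has mean zero, so its variance is exactly the average of
  -- `f²`. For `ψ`, the squared mean is dropped at the end.
  simp_rw [hu, ← Finset.sum_mul, hf] at h1
  rw [qfi_locDiag, key _ (sum_prob b hψ)]
  rw [div_eq_mul_inv]
  nlinarith [sq_nonneg (∑ i, f i * prob b ψ i)]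

end Separable

/-! ### Union bound over a net of local bases -/

section Net

variable {n d : ℕ}

/-- Telescoping: replace one factor at a time, the others having norm at most 1. -/
theorem norm_prod_sub_prod_le_sum {ι : Type*} (S : Finset ι) (u w : ι → ℂ)
    (hu : ∀ j, ‖u j‖ ≤ 1) (hw : ∀ j, ‖w j‖ ≤ 1) :
    ‖∏ j ∈ S, u j - ∏ j ∈ S, w j‖ ≤ ∑ j ∈ S, ‖u j - w j‖ := by
  classical
  induction S using Finset.induction_on with
  | empty => simp
  | insert a S ha ih =>
    rw [Finset.prod_insert ha, Finset.prod_insert ha, Finset.sum_insert ha]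
    have hp : ‖∏ j ∈ S, u j‖ ≤ 1 := by
      rw [norm_prod]
      exact Finset.prod_le_one (fun _ _ => norm_nonneg _) fun j _ => hu j
    have : u a * ∏ j ∈ S, u j - w a * ∏ j ∈ S, w j
        = (u a - w a) * ∏ j ∈ S, u j + w a * (∏ j ∈ S, u j - ∏ j ∈ S, w j) := by ring
    rw [this]
    refine (norm_add_le _ _).trans ?_
    rw [norm_mul, norm_mul]
    exact add_le_add (mul_le_of_le_one_right (norm_nonneg _) hp)
      ((mul_le_of_le_one_left (norm_nonneg _) (hw a)).trans ih)

theorem norm_basis_apply_le_one (b : OrthonormalBasis (Fin d) ℂ (Qudit d)) (k l : Fin d) :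
    ‖b k l‖ ≤ 1 :=
  (PiLp.norm_apply_le _ _).trans (b.norm_eq_one k).le

/-- Each of the `d^n` coordinates moves by at most `nε`; the resulting factor `√(d^n)` is weakened
to `d^n`. -/
theorem norm_productBasisVec_sub_le {b b' : LocalBases n d} {ε : ℝ} (hε : 0 ≤ ε)
    (h : ∀ j k l, ‖b j k l - b' j k l‖ ≤ ε) (i : Fin n → Fin d) :
    ‖productBasisVec b i - productBasisVec b' i‖ ≤ (d : ℝ) ^ n * (n * ε) := by
  refine (pow_le_pow_iff_left₀ (norm_nonneg _) (by positivity) two_ne_zero).1 ?_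
  rw [EuclideanSpace.norm_sq_eq]
  have hc : ∀ l ∈ (Finset.univ : Finset (Fin n → Fin d)),
      ‖(productBasisVec b i - productBasisVec b' i) l‖ ^ 2 ≤ (n * ε) ^ 2 := by
    intro l _
    refine pow_le_pow_left₀ (norm_nonneg _) ?_ 2
    refine (norm_prod_sub_prod_le_sum Finset.univ (fun j => b j (i j) (l j))
      (fun j => b' j (i j) (l j)) (fun j => norm_basis_apply_le_one _ _ _)
      (fun j => norm_basis_apply_le_one _ _ _)).trans ?_
    refine (Finset.sum_le_card_nsmul _ _ ε fun j _ => h j (i j) (l j)).trans ?_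
    simp
  refine (Finset.sum_le_sum hc).trans ?_
  rw [Finset.sum_const, Finset.card_univ, nsmul_eq_mul, mul_pow ((d : ℝ) ^ n)]
  refine mul_le_mul_of_nonneg_right ?_ (sq_nonneg _)
  have : Fintype.card (Fin n → Fin d) ≤ (d ^ n) ^ 2 := by
    simpa using Nat.le_self_pow two_ne_zero (d ^ n)
  exact_mod_cast this

theorem abs_prob_sub_le {b b' : LocalBases n d} {ε : ℝ} (hε : 0 ≤ ε)
    (h : ∀ j k l, ‖b j k l - b' j k l‖ ≤ ε) {ψ : Qudits n d} (hψ : ‖ψ‖ = 1) (i : Fin n → Fin d) :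
    |prob b ψ i - prob b' ψ i| ≤ 2 * ((d : ℝ) ^ n * (n * ε)) := by
  have hle : ∀ c : LocalBases n d, ‖inner ℂ (productBasisVec c i) ψ‖ ≤ 1 := by
    intro c
    refine (norm_inner_le_norm _ _).trans ?_
    rw [hψ, (orthonormal_productBasisVec c).1 i, mul_one]
  have h1 : |‖inner ℂ (productBasisVec b i) ψ‖ - ‖inner ℂ (productBasisVec b' i) ψ‖|
      ≤ (d : ℝ) ^ n * (n * ε) := by
    refine (abs_norm_sub_norm_le _ _).trans ?_
    rw [← inner_sub_left]
    refine (norm_inner_le_norm _ _).trans ?_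
    rw [hψ, mul_one]
    exact norm_productBasisVec_sub_le hε h i
  rw [prob, prob, sq_sub_sq, abs_mul]
  refine mul_le_mul ?_ h1 (abs_nonneg _) zero_le_two
  rw [abs_of_nonneg (by positivity)]
  linarith [hle b, hle b']

/-- The coordinates of the local basis vectors, rounded to multiples of `1 / K`. -/
noncomputable def gridIndex (K : ℕ) (b : LocalBases n d) (p : Fin n × Fin d × Fin d × Bool) : ℤ :=
  ⌊(K : ℝ) * (if p.2.2.2 then (b p.1 p.2.1 p.2.2.1).re else (b p.1 p.2.1 p.2.2.1).im)⌋

/-- There are thus at most `(2K+1)^(2nd²)` grid cells. -/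
theorem gridIndex_mem (K : ℕ) (b : LocalBases n d) (p : Fin n × Fin d × Fin d × Bool) :
    gridIndex K b p ∈ Finset.Icc (-(K : ℤ)) K := by
  have hn := norm_basis_apply_le_one (b p.1) p.2.1 p.2.2.1
  have hx : |(if p.2.2.2 then (b p.1 p.2.1 p.2.2.1).re else (b p.1 p.2.1 p.2.2.1).im)| ≤ 1 := by
    split_ifs
    · exact (Complex.abs_re_le_norm _).trans hn
    · exact (Complex.abs_im_le_norm _).trans hn
  have hK : (0 : ℝ) ≤ K := Nat.cast_nonneg K
  rw [Finset.mem_Icc, gridIndex]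
  rw [abs_le] at hx
  constructor
  · rw [Int.le_floor]
    push_cast
    nlinarith [hx.1]
  · have : (⌊(K : ℝ) * (if p.2.2.2 then (b p.1 p.2.1 p.2.2.1).re
        else (b p.1 p.2.1 p.2.2.1).im)⌋ : ℝ) ≤ K := (Int.floor_le _).trans (by nlinarith [hx.2])
    exact_mod_cast this

theorem norm_sub_le_of_gridIndex_eq {K : ℕ} (hK : 0 < K) {b b' : LocalBases n d}
    (h : gridIndex K b = gridIndex K b') (j : Fin n) (k l : Fin d) :
    ‖b j k l - b' j k l‖ ≤ 2 / K := by
  have hK' : (0 : ℝ) < K := by exact_mod_cast hK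
  have key : ∀ x y : ℝ, ⌊(K : ℝ) * x⌋ = ⌊(K : ℝ) * y⌋ → |x - y| ≤ 1 / K := by
    intro x y hxy
    have h1 := Int.abs_sub_lt_one_of_floor_eq_floor hxy
    rw [← mul_sub, abs_mul, abs_of_pos hK'] at h1
    rw [le_div_iff₀ hK']
    linarith
  have hre := key _ _ (by simpa [gridIndex] using congrFun h (j, k, l, true))
  have him := key _ _ (by simpa [gridIndex] using congrFun h (j, k, l, false))
  refine (Complex.norm_le_abs_re_add_abs_im _).trans ?_
  rw [Complex.sub_re, Complex.sub_im]
  refine (add_le_add hre him).trans (le_of_eq ?_)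
  ring

/-- Concentration of the expectation of an observable, uniformly over all product bases. -/
theorem haarState_exists_basis_le (hd : 0 < d) (x : (Fin n → Fin d) → ℝ) {L t : ℝ} (ht : 0 < t)
    (htL : t ≤ L) (hx : ∀ i, |x i| ≤ L) {K : ℕ} (hK : 0 < K)
    (hKt : 8 * ((d : ℝ) ^ n) ^ 2 * L * n ≤ t * K) :
    haarState n d {ψ | ∃ b : LocalBases n d, (∑ i, x i) / (d : ℝ) ^ n + t <
        ∑ i, x i * prob b (ψ : Qudits n d) i}
      ≤ ENNReal.ofReal ((2 * K + 1) ^ (n * (d * (d * 2))) *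
        Real.exp (-((d : ℝ) ^ n * t ^ 2 / (288 * L ^ 2)))) := by
  have : Nonempty (Fin d) := ⟨⟨0, hd⟩⟩
  have hK' : (0 : ℝ) < K := by exact_mod_cast hK
  have hL : 0 < L := ht.trans_le htL
  let G := Fin n × Fin d × Fin d × Bool → Finset.Icc (-(K : ℤ)) K
  let r : LocalBases n d → G := fun b p => ⟨gridIndex K b p, gridIndex_mem K b p⟩
  -- Bad states are sorted by the cell of a basis witnessing the deviation.
  let E : G → Set (Metric.sphere (0 : Qudits n d) 1) := fun g => {ψ | ∃ b : LocalBases n d,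
    r b = g ∧ (∑ i, x i) / (d : ℝ) ^ n + t < ∑ i, x i * prob b (ψ : Qudits n d) i}
  have hE : ∀ g, haarState n d (E g)
      ≤ ENNReal.ofReal (Real.exp (-((d : ℝ) ^ n * t ^ 2 / (288 * L ^ 2)))) := by
    intro g
    by_cases hg : ∃ b, r b = g
    · obtain ⟨b', rfl⟩ := hg
      -- Any basis in a nonempty cell represents it. Moving to `b'` costs at most `t/2`, leaving
      -- deviation `t/2` for concentration, whence `288 = 4 · 72`.
      have hsub : E (r b') ⊆ {ψ | (∑ i, x i) / Fintype.card (Fin n → Fin d) + t / 2 <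
          ∑ i, x i * ‖inner ℂ (productBasis b' i) (ψ : Qudits n d)‖ ^ 2} := by
        rintro ψ ⟨b, hb, hψ⟩
        have hgrid : gridIndex K b = gridIndex K b' :=
          funext fun p => congrArg Subtype.val (congrFun hb p)
        have hdiff := abs_prob_sub_le (by positivity) (norm_sub_le_of_gridIndex_eq hK hgrid)
          (norm_eq_of_mem_sphere ψ)
        have hsum : ∑ i, x i * prob b (ψ : Qudits n d) i - ∑ i, x i * prob b' (ψ : Qudits n d) i
            ≤ t / 2 := by
          rw [← Finset.sum_sub_distrib]
          calc ∑ i, (x i * prob b (ψ : Qudits n d) i - x i * prob b' (ψ : Qudits n d) i)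
              ≤ ∑ _i : Fin n → Fin d, L * (2 * ((d : ℝ) ^ n * (n * (2 / K)))) := by
                refine Finset.sum_le_sum fun i _ => ?_
                rw [← mul_sub]
                refine (le_abs_self _).trans ?_
                rw [abs_mul]
                exact mul_le_mul (hx i) (hdiff i) (abs_nonneg _) hL.le
            _ = 8 * ((d : ℝ) ^ n) ^ 2 * L * n / K / 2 := by
                rw [Finset.sum_const, Finset.card_univ, nsmul_eq_mul]
                simp only [Fintype.card_pi, Fintype.card_fin, Finset.prod_const, Finset.card_univ]
                push_cast
                ring
            _ ≤ t / 2 := by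
                have := (div_le_iff₀ hK').2 hKt
                linarith
        have hcard : (Fintype.card (Fin n → Fin d) : ℝ) = (d : ℝ) ^ n := by simp
        simp only [Set.mem_ofPred_eq, productBasis_apply, hcard]
        change _ < ∑ i, x i * prob b' (ψ : Qudits n d) i
        linarith
      refine (measure_mono hsub).trans ?_
      have h1 := toSphere_concentration (productBasis b') x (half_pos ht) (by linarith) hx
      rw [haarState, Measure.smul_apply, smul_eq_mul]
      refine h1.trans (le_of_eq ?_)
      congr 3
      simp only [Fintype.card_pi, Fintype.card_fin, Finset.prod_const, Finset.card_univ]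
      push_cast
      ring
    · have : E g = ∅ := by
        ext ψ
        simp only [E, Set.mem_ofPred_eq, Set.mem_empty_iff_false, iff_false]
        rintro ⟨b, hb, -⟩
        exact hg ⟨b, hb⟩
      rw [this, measure_empty]
      exact zero_le
  have hcover : {ψ : Metric.sphere (0 : Qudits n d) 1 | ∃ b : LocalBases n d,
      (∑ i, x i) / (d : ℝ) ^ n + t < ∑ i, x i * prob b (ψ : Qudits n d) i} ⊆ ⋃ g, E g := by
    rintro ψ ⟨b, hb⟩
    exact Set.mem_iUnion.2 ⟨r b, b, rfl, hb⟩
  refine (measure_mono hcover).trans ((measure_iUnion_fintype_le _ _).trans ?_)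
  refine (Finset.sum_le_sum fun g _ => hE g).trans (le_of_eq ?_)
  rw [Finset.sum_const, Finset.card_univ, nsmul_eq_mul, ENNReal.ofReal_mul (by positivity)]
  congr 1
  have hcardG : Fintype.card G = (2 * K + 1) ^ (n * (d * (d * 2))) := by
    simp only [G, Fintype.card_fun, Fintype.card_prod, Fintype.card_fin, Fintype.card_bool,
      Fintype.card_coe, Int.card_Icc]
    congr 1
    omega
  rw [hcardG, ← ENNReal.ofReal_natCast]
  push_cast
  rfl

end Net

/-! ### The bound at fixed size -/

section FiniteSize

variable {n d : ℕ}

/-- If all pair correlations are close to those in the uniform distribution, then so is the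
second moment of a linear combination. -/
theorem sum_sq_mul_sub_le {ι κ : Type*} [Fintype ι] [Fintype κ] (g : κ → ι → ℝ) (ν : κ → ℝ)
    (w : ι → ℝ) {δ R : ℝ} (hδ : 0 ≤ δ)
    (hg : ∀ k l, |∑ i, g k i * g l i * w i| ≤ δ) (hν : ∑ k, |ν k| ≤ R) :
    ∑ i, (∑ k, ν k * g k i) ^ 2 * w i ≤ R ^ 2 * δ := by
  have h1 : ∑ i, (∑ k, ν k * g k i) ^ 2 * w i
      = ∑ k, ∑ l, ν k * ν l * ∑ i, g k i * g l i * w i := by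
    simp_rw [pow_two, Finset.sum_mul_sum, Finset.sum_mul, Finset.mul_sum]
    rw [Finset.sum_comm]
    refine Finset.sum_congr rfl fun k _ => ?_
    rw [Finset.sum_comm]
    exact Finset.sum_congr rfl fun l _ => Finset.sum_congr rfl fun i _ => by ring
  have h0 : 0 ≤ ∑ k, |ν k| := Finset.sum_nonneg fun _ _ => abs_nonneg _
  calc ∑ i, (∑ k, ν k * g k i) ^ 2 * w i
      ≤ ∑ k, ∑ l, |ν k| * |ν l| * δ := by
        rw [h1]
        refine Finset.sum_le_sum fun k _ => Finset.sum_le_sum fun l _ => ?_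
        refine (le_abs_self _).trans ?_
        rw [abs_mul, abs_mul]
        exact mul_le_mul_of_nonneg_left (hg k l) (by positivity)
    _ = (∑ k, |ν k|) ^ 2 * δ := by
        rw [pow_two, Finset.sum_mul_sum, Finset.sum_mul]
        exact Finset.sum_congr rfl fun k _ => by rw [Finset.sum_mul]
    _ ≤ R ^ 2 * δ := by gcongr

/-- The eigenvalue families of `A_0` and of the `A_m`, shifted to have mean zero. -/
noncomputable def centered {s : ℕ} (a0 : (Fin n → Fin d) → ℝ) (a : Fin s → (Fin n → Fin d) → ℝ)
    (k : Option (Fin s)) (i : Fin n → Fin d) : ℝ :=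
  k.elim a0 a i - (∑ i', k.elim a0 a i') / (d : ℝ) ^ n

theorem sum_centered (hd : 0 < d) {s : ℕ} (a0 : (Fin n → Fin d) → ℝ)
    (a : Fin s → (Fin n → Fin d) → ℝ) (k : Option (Fin s)) : ∑ i, centered a0 a k i = 0 := by
  have hd' : (d : ℝ) ^ n ≠ 0 := pow_ne_zero _ (by exact_mod_cast hd.ne')
  simp only [centered, Finset.sum_sub_distrib, Finset.sum_const, Finset.card_univ,
    Fintype.card_pi, Fintype.card_fin, Finset.prod_const, nsmul_eq_mul]
  push_cast
  field_simp
  ring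

theorem abs_centered_le (hd : 0 < d) {s : ℕ} {a0 : (Fin n → Fin d) → ℝ}
    {a : Fin s → (Fin n → Fin d) → ℝ} {M : ℝ} (ha0 : ∀ i, |a0 i| ≤ M) (ha : ∀ m i, |a m i| ≤ M)
    (k : Option (Fin s)) (i : Fin n → Fin d) : |centered a0 a k i| ≤ 2 * M := by
  have hd' : (0 : ℝ) < (d : ℝ) ^ n := pow_pos (by exact_mod_cast hd) _
  have hk : ∀ i, |k.elim a0 a i| ≤ M := by
    cases k with
    | none => exact ha0
    | some m => exact ha m
  have hm : |(∑ i', k.elim a0 a i') / (d : ℝ) ^ n| ≤ M := by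
    rw [abs_div, abs_of_pos hd', div_le_iff₀ hd']
    refine (Finset.abs_sum_le_sum_abs _ _).trans ((Finset.sum_le_sum fun i _ => hk i).trans ?_)
    simp [mul_comm]
  refine (abs_sub _ _).trans ?_
  linarith [hk i]

/-- A bound at fixed size on the probability that a random state beats all separable states. -/
theorem haarState_advantage_le (hd : 0 < d) {s : ℕ} {A B M δ c : ℝ} (hA : 0 < A)
    (I : Finset (Fin n)) (e : LocalBases n d)
    {a0 : (Fin n → Fin d) → ℝ} {a : Fin s → (Fin n → Fin d) → ℝ}
    (ha0 : ∀ i, |a0 i| ≤ M) (ha : ∀ m i, |a m i| ≤ M) (hδ : 0 < δ) (hδM : δ ≤ 4 * M ^ 2)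
    (hδc : 4 * ((1 + s * B) ^ 2 * δ) ≤ c) {K : ℕ} (hK : 0 < K)
    (hKδ : 8 * ((d : ℝ) ^ n) ^ 2 * (4 * M ^ 2) * n ≤ δ * K) :
    haarState n d {ψ | (c : EReal) < ⨆ H ∈ hamiltonianSet A B I e a0 a,
        ((qfi (ψ : Qudits n d) H - maxSepQFI H : ℝ) : EReal)}
      ≤ ENNReal.ofReal ((s + 1) * ((s + 1) * 2) * ((2 * K + 1) ^ (n * (d * (d * 2))) *
        Real.exp (-((d : ℝ) ^ n * δ ^ 2 / (288 * (4 * M ^ 2) ^ 2))))) := by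
  -- `none` stands for `A_0`; the Boolean sign makes the one-sided deviation bounds two-sided.
  let x : Option (Fin s) × Option (Fin s) × Bool → (Fin n → Fin d) → ℝ := fun p i =>
    (if p.2.2 then 1 else -1) * (centered a0 a p.1 i * centered a0 a p.2.1 i)
  let E : Option (Fin s) × Option (Fin s) × Bool → Set (Metric.sphere (0 : Qudits n d) 1) :=
    fun p => {ψ | ∃ b : LocalBases n d, (∑ i, x p i) / (d : ℝ) ^ n + δ <
        ∑ i, x p i * prob b (ψ : Qudits n d) i}
  have hx : ∀ p i, |x p i| ≤ 4 * M ^ 2 := by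
    intro p i
    have h1 := abs_centered_le hd ha0 ha p.1 i
    have h2 := abs_centered_le hd ha0 ha p.2.1 i
    have h3 : |(if p.2.2 then (1 : ℝ) else -1)| = 1 := by split_ifs <;> simp
    simp only [x]
    rw [abs_mul, abs_mul, h3, one_mul]
    refine (mul_le_mul h1 h2 (abs_nonneg _) ((abs_nonneg _).trans h1)).trans (le_of_eq ?_)
    ring
  have hE : ∀ p, haarState n d (E p) ≤ ENNReal.ofReal ((2 * K + 1) ^ (n * (d * (d * 2))) *
        Real.exp (-((d : ℝ) ^ n * δ ^ 2 / (288 * (4 * M ^ 2) ^ 2)))) := fun p =>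
    haarState_exists_basis_le hd (x p) hδ hδM (hx p) hK hKδ
  have hcover : {ψ : Metric.sphere (0 : Qudits n d) 1 | (c : EReal) <
      ⨆ H ∈ hamiltonianSet A B I e a0 a,
        ((qfi (ψ : Qudits n d) H - maxSepQFI H : ℝ) : EReal)} ⊆ ⋃ p, E p := by
    intro ψ hψ
    by_contra hnot
    simp only [Set.mem_iUnion, E, Set.mem_ofPred_eq, not_exists, not_lt] at hnot
    simp only [Set.mem_ofPred_eq, lt_iSup_iff] at hψ
    obtain ⟨H, ⟨φ, μ, hμ, rfl⟩, hlt⟩ := hψ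
    rw [EReal.coe_lt_coe_iff] at hlt
    set b := mixBases I φ e
    have hψ1 : ‖(ψ : Qudits n d)‖ = 1 := norm_eq_of_mem_sphere ψ
    let ν : Option (Fin s) → ℝ := fun k => k.elim 1 μ
    have hν : ∑ k, |ν k| ≤ 1 + s * B := by
      rw [Fintype.sum_option]
      have : ∀ m ∈ (Finset.univ : Finset (Fin s)), |ν (some m)| ≤ B := by
        intro m _
        change |μ m| ≤ B
        rcases hμ m with h | h
        · rw [Set.mem_Icc] at h
          exact abs_le.2 ⟨h.1, by linarith⟩
        · rw [Set.mem_Icc] at h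
          exact abs_le.2 ⟨by linarith, h.2⟩
      have h2 := Finset.sum_le_sum this
      rw [Finset.sum_const, Finset.card_univ, Fintype.card_fin, nsmul_eq_mul] at h2
      have h3 : |ν none| = 1 := abs_one
      linarith
    let f : (Fin n → Fin d) → ℝ := fun i => ∑ k, ν k * centered a0 a k i
    -- The means removed by centering add up to a multiple of the identity, which does not affect
    -- the variance.
    let τ : ℝ := ∑ k, ν k * ((∑ i', k.elim a0 a i') / (d : ℝ) ^ n)
    have hf0 : ∑ i, f i = 0 := by
      simp only [f]
      rw [Finset.sum_comm]
      simp_rw [← Finset.mul_sum, sum_centered hd, mul_zero, Finset.sum_const_zero]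
    have hH : locDiag b a0 + ∑ m, (μ m : ℂ) • locDiag b (a m) = locDiag b fun i => f i + τ := by
      rw [locDiag_add_sum]
      congr 1
      ext i
      simp only [f, τ]
      rw [← Finset.sum_add_distrib, Fintype.sum_option]
      simp [ν, centered]
      exact Finset.sum_congr rfl fun m _ => by ring
    rw [hH] at hlt
    have h1 := qfi_sub_maxSepQFI_le hd b f τ hf0 hψ1
    have h2 : ∑ i, f i ^ 2 * (prob b (ψ : Qudits n d) i - ((d : ℝ) ^ n)⁻¹)
        ≤ (1 + s * B) ^ 2 * δ := by
      refine sum_sq_mul_sub_le (centered a0 a) ν _ hδ.le (fun k l => ?_) hν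
      have hp := hnot (k, l, true) b
      have hm := hnot (k, l, false) b
      simp only [x, if_true, Bool.false_eq_true, if_false, one_mul, neg_mul,
        Finset.sum_neg_distrib, neg_div] at hp hm
      simp_rw [mul_sub, Finset.sum_sub_distrib, ← Finset.sum_mul, ← div_eq_mul_inv]
      rw [abs_le]
      constructor <;> linarith
    simp_rw [mul_sub, Finset.sum_sub_distrib, ← Finset.sum_mul, ← div_eq_mul_inv] at h2
    linarith
  refine (measure_mono hcover).trans ((measure_iUnion_fintype_le _ _).trans ?_)
  refine (Finset.sum_le_sum fun p _ => hE p).trans (le_of_eq ?_)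
  rw [Finset.sum_const, Finset.card_univ, nsmul_eq_mul,
    ENNReal.ofReal_mul (p := ((s : ℝ) + 1) * ((s + 1) * 2)) (by positivity)]
  congr 1
  rw [← ENNReal.ofReal_natCast]
  congr 1
  simp

end FiniteSize

/-! ### Growth estimates -/

section Asymptotics

theorem eventually_mul_pow_le {r : ℝ} (hr : 1 < r) (k : ℕ) {C κ : ℝ} (hκ : 0 < κ) :
    ∀ᶠ n : ℕ in atTop, C * (n : ℝ) ^ k ≤ κ * r ^ n := by
  have h := (isLittleO_pow_const_const_pow_of_one_lt (R := ℝ) k hr).def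
    (c := κ / (|C| + 1)) (by positivity)
  filter_upwards [h] with n hn
  have hr' : 0 < r ^ n := pow_pos (by linarith) n
  rw [Real.norm_of_nonneg (by positivity), Real.norm_of_nonneg hr'.le, div_mul_eq_mul_div,
    le_div_iff₀ (by positivity)] at hn
  have : (0 : ℝ) ≤ (n : ℝ) ^ k := by positivity
  nlinarith [le_abs_self C]

theorem IsSubexp.eventually_le {d : ℕ} (hd : 2 ≤ d) {f : ℕ → ℝ} (hf : IsSubexp d f) {η : ℝ}
    (hη : 0 < η) : ∀ᶠ n : ℕ in atTop, f n ≤ ((d : ℝ) ^ η) ^ n := by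
  obtain ⟨g, hg, hfg⟩ := hf
  have hd1 : (1 : ℝ) ≤ d := by exact_mod_cast (by omega : 1 ≤ d)
  filter_upwards [hfg, hg.def hη] with n h1 h2
  refine h1.trans ?_
  rw [← Real.rpow_mul_natCast (by linarith)]
  refine Real.rpow_le_rpow_of_exponent_le hd1 ?_
  rw [Real.norm_eq_abs, Real.norm_of_nonneg (Nat.cast_nonneg n)] at h2
  exact (le_abs_self _).trans h2

theorem tendsto_exp_mul_sq_sub_mul_pow {r : ℝ} (hr : 1 < r) (C : ℝ) {κ : ℝ} (hκ : 0 < κ) :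
    Tendsto (fun n : ℕ => Real.exp (C * (n : ℝ) ^ 2 - κ * r ^ n)) atTop (𝓝 0) := by
  refine Real.tendsto_exp_atBot.comp ?_
  have h1 : Tendsto (fun n : ℕ => -(κ / 2 * r ^ n)) atTop atBot :=
    tendsto_neg_atTop_atBot.comp
      ((tendsto_pow_atTop_atTop_of_one_lt hr).const_mul_atTop (half_pos hκ))
  refine tendsto_atBot_mono' _ ?_ h1
  filter_upwards [eventually_mul_pow_le hr 2 (C := C) (half_pos hκ)] with n hn
  linarith

/-- The size of the net times the size of the deviation probability tends to zero. -/
theorem tendsto_net_mul_exp {d : ℕ} (hd : 1 ≤ d) {r : ℝ} (hr : 1 < r) (N : ℕ) {κ : ℝ}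
    (hκ : 0 < κ) :
    Tendsto (fun n : ℕ => 8 * (r ^ n) ^ 2 * ((3 * (d : ℝ) ^ (4 * n)) ^ (n * N) *
      Real.exp (-(κ * r ^ n)))) atTop (𝓝 0) := by
  have hd' : (1 : ℝ) ≤ d := by exact_mod_cast hd
  have hlr : 0 ≤ Real.log r := Real.log_nonneg hr.le
  have hld : 0 ≤ Real.log d := Real.log_nonneg hd'
  -- All factors but the last are at most `exp(O(n²))`, negligible against `exp(-κ r^n)`.
  refine tendsto_of_tendsto_of_tendsto_of_le_of_le' tendsto_const_nhds
    (tendsto_exp_mul_sq_sub_mul_pow hr (8 + 2 * Real.log r + (3 + 4 * Real.log d) * N) hκ) ?_ ?_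
  · exact Eventually.of_forall fun n => by positivity
  · filter_upwards [eventually_ge_atTop 1] with n hn
    have hn1 : (1 : ℝ) ≤ n := by exact_mod_cast hn
    have hn2 : (n : ℝ) ≤ (n : ℝ) ^ 2 := by nlinarith
    have h8 : (8 : ℝ) ≤ Real.exp (8 * (n : ℝ) ^ 2) := by
      linarith [Real.add_one_le_exp (8 * (n : ℝ) ^ 2)]
    have hq : (r ^ n) ^ 2 ≤ Real.exp (2 * Real.log r * (n : ℝ) ^ 2) := by
      have : (r ^ n) ^ 2 = Real.exp (2 * Real.log r * n) := by
        rw [← pow_mul, ← Real.exp_log (pow_pos (by linarith : (0 : ℝ) < r) (n * 2)), Real.log_pow]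
        congr 1
        push_cast
        ring
      rw [this]
      gcongr
    have h3 : (3 : ℝ) * (d : ℝ) ^ (4 * n) ≤ Real.exp ((3 + 4 * Real.log d) * n) := by
      have hdn : (d : ℝ) ^ (4 * n) = Real.exp (4 * Real.log d * n) := by
        rw [← Real.exp_log (pow_pos (by linarith : (0 : ℝ) < d) (4 * n)), Real.log_pow]
        congr 1
        push_cast
        ring
      rw [hdn, add_mul, Real.exp_add]
      gcongr
      linarith [Real.add_one_le_exp (3 * (n : ℝ))]
    have h4 : (3 * (d : ℝ) ^ (4 * n)) ^ (n * N)
        ≤ Real.exp ((3 + 4 * Real.log d) * N * (n : ℝ) ^ 2) := by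
      refine (pow_le_pow_left₀ (by positivity) h3 _).trans (le_of_eq ?_)
      rw [← Real.exp_nat_mul]
      congr 1
      push_cast
      ring
    calc 8 * (r ^ n) ^ 2 * ((3 * (d : ℝ) ^ (4 * n)) ^ (n * N) * Real.exp (-(κ * r ^ n)))
        ≤ Real.exp (8 * (n : ℝ) ^ 2) * Real.exp (2 * Real.log r * (n : ℝ) ^ 2) *
          (Real.exp ((3 + 4 * Real.log d) * N * (n : ℝ) ^ 2) * Real.exp (-(κ * r ^ n))) := by
          gcongr
      _ = _ := by
          rw [← Real.exp_add, ← Real.exp_add, ← Real.exp_add]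
          congr 1
          ring

end Asymptotics

end QMetrology

/-! ### Choice of parameters -/

theorem mainTheorem2 (d : ℕ) (hd : 2 ≤ d) (A B : ℝ) (hA : 0 < A) (hAB : A < B)
    (I : (n : ℕ) → Finset (Fin n)) (e : (n : ℕ) → QMetrology.LocalBases n d)
    (s : ℕ → ℕ)
    (a0 : (n : ℕ) → (Fin n → Fin d) → ℝ)
    (a : (n : ℕ) → Fin (s n) → (Fin n → Fin d) → ℝ)
    (hs : QMetrology.IsSubexp d (fun n => (s n : ℝ)))
    (ha0 : QMetrology.IsSubexp d (fun n => ‖QMetrology.locDiag (e n) (a0 n)‖))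
    (ha : (fun n => ⨆ m : Fin (s n), ‖QMetrology.locDiag (e n) (a n m)‖)
      =Θ[atTop] (fun n : ℕ => (n : ℝ)))
    (c : ℝ) (hc : 0 < c) :
    Tendsto
      (fun n : ℕ => QMetrology.haarState n d
        {ψ | (c : EReal) <
          ⨆ H ∈ QMetrology.hamiltonianSet A B (I n) (e n) (a0 n) (a n),
            ((QMetrology.qfi (ψ : QMetrology.Qudits n d) H - QMetrology.maxSepQFI H : ℝ) :
              EReal)})
      atTop (𝓝 0) := by
  have hB : 0 < B := hA.trans hAB
  have hd0 : 0 < d := by omega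
  have hd1 : (1 : ℝ) < d := by exact_mod_cast (by omega : 1 < d)
  -- With `q = r^n`, the dimension is `q^32`, while `s n` and all eigenvalues are eventually at most
  -- `q`; every estimate becomes a comparison of powers of `q`.
  set r : ℝ := (d : ℝ) ^ ((1 : ℝ) / 32) with hr
  have hr1 : 1 < r := Real.one_lt_rpow hd1 (by norm_num)
  have hr32 : r ^ 32 = d := by
    rw [hr, ← Real.rpow_mul_natCast (by linarith)]
    norm_num
  -- Since `1 + sB ≤ (1 + B)q`, the tolerance `δ = κ/q²` contributes at most `c`.
  set κ : ℝ := c / (4 * (1 + B) ^ 2) with hκdef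
  have hκ : 0 < κ := by positivity
  obtain ⟨C, hC⟩ := ha.1.bound
  have hlim := QMetrology.tendsto_net_mul_exp hd0 hr1 (d * (d * 2))
    (κ := κ ^ 2 / 4608) (by positivity)
  have hlim' := ENNReal.tendsto_ofReal hlim
  rw [ENNReal.ofReal_zero] at hlim'
  refine tendsto_of_tendsto_of_tendsto_of_le_of_le' tendsto_const_nhds hlim'
    (Eventually.of_forall fun n => zero_le) ?_
  filter_upwards [hs.eventually_le hd (by norm_num : (0 : ℝ) < 1 / 32),
    ha0.eventually_le hd (by norm_num : (0 : ℝ) < 1 / 32), hC,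
    QMetrology.eventually_mul_pow_le hr1 1 (C := C) one_pos,
    QMetrology.eventually_mul_pow_le hr1 1 (C := 32) hκ,
    QMetrology.eventually_mul_pow_le hr1 0 (C := κ) one_pos] with n hsn h0n hCn hCr h32 hκr
  rw [← hr] at hsn h0n
  set q : ℝ := r ^ n with hq
  have hq1 : 1 ≤ q := one_le_pow₀ hr1.le
  have hq0 : 0 < q := by linarith
  have hD : (d : ℝ) ^ n = q ^ 32 := by rw [hq, ← hr32, ← pow_mul, ← pow_mul, mul_comm]
  rw [pow_one, one_mul] at hCr
  rw [pow_one] at h32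
  rw [pow_zero, mul_one, one_mul] at hκr
  have hb0 : ∀ i, |a0 n i| ≤ q := fun i =>
    (QMetrology.abs_le_norm_locDiag (e n) (a0 n) i).trans h0n
  have hb : ∀ m i, |a n m i| ≤ q := by
    intro m i
    refine (QMetrology.abs_le_norm_locDiag (e n) (a n m) i).trans ?_
    refine (le_ciSup (f := fun m => ‖QMetrology.locDiag (e n) (a n m)‖)
      (Set.finite_range _).bddAbove m).trans ?_
    refine (le_abs_self _).trans (hCn.trans ?_)
    rwa [Real.norm_of_nonneg (Nat.cast_nonneg n)]
  have hδc : 4 * ((1 + s n * B) ^ 2 * (κ / q ^ 2)) ≤ c := by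
    have h1 : (1 + s n * B) ^ 2 ≤ ((1 + B) * q) ^ 2 := by
      refine pow_le_pow_left₀ (by positivity) ?_ 2
      nlinarith [mul_le_mul_of_nonneg_right hsn hB.le]
    calc 4 * ((1 + s n * B) ^ 2 * (κ / q ^ 2)) ≤ 4 * (((1 + B) * q) ^ 2 * (κ / q ^ 2)) := by gcongr
      _ = c := by
        rw [hκdef]
        field_simp
  have hδM : κ / q ^ 2 ≤ 4 * q ^ 2 := by
    rw [div_le_iff₀ (by positivity)]
    have h1 : q ≤ q ^ 4 := le_self_pow₀ hq1 (by norm_num)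
    nlinarith
  -- `K = d^(4n) = q^128` is ample: with `32n ≤ κq`, the grid condition needs only `q^69`.
  have hKδ : 8 * ((d : ℝ) ^ n) ^ 2 * (4 * q ^ 2) * n ≤ κ / q ^ 2 * ((d ^ (4 * n) : ℕ) : ℝ) := by
    push_cast
    have hD4 : (d : ℝ) ^ (4 * n) = q ^ 128 := by
      rw [mul_comm, pow_mul, hD, ← pow_mul]
    rw [hD4, hD, div_mul_eq_mul_div, le_div_iff₀ (by positivity)]
    calc 8 * (q ^ 32) ^ 2 * (4 * q ^ 2) * n * q ^ 2 = 32 * n * q ^ 68 := by ring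
      _ ≤ κ * q * q ^ 68 := by gcongr
      _ = κ * q ^ 69 := by ring
      _ ≤ κ * q ^ 128 := by gcongr; norm_num
  refine (QMetrology.haarState_advantage_le hd0 hA (I n) (e n) hb0 hb (by positivity) hδM hδc
    (K := d ^ (4 * n)) (by positivity) hKδ).trans (ENNReal.ofReal_le_ofReal ?_)
  -- Here `4608 = 288 · 16`; the exponent is of order `q^24`, of which a single power of `q`
  -- suffices.
  have hexp : κ ^ 2 / 4608 * q ≤ (d : ℝ) ^ n * (κ / q ^ 2) ^ 2 / (288 * (4 * q ^ 2) ^ 2) := by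
    have h1 : (d : ℝ) ^ n * (κ / q ^ 2) ^ 2 / (288 * (4 * q ^ 2) ^ 2)
        = κ ^ 2 / 4608 * q ^ 24 := by
      rw [hD]
      field_simp
      norm_num
    rw [h1]
    gcongr
    exact le_self_pow₀ hq1 (by norm_num)
  have hs1 : ((s n : ℝ) + 1) * ((s n + 1) * 2) ≤ 8 * q ^ 2 := by
    have : (s n : ℝ) + 1 ≤ 2 * q := by linarith
    nlinarith [Nat.cast_nonneg (α := ℝ) (s n)]
  have hK1 : 2 * ((d ^ (4 * n) : ℕ) : ℝ) + 1 ≤ 3 * (d : ℝ) ^ (4 * n) := by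
    push_cast
    linarith [one_le_pow₀ hd1.le (n := 4 * n)]
  gcongr
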